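/- Let $p$ be a prime and let $X, Z$ be the generalized Pauli operators on $\mathbb{C}^p$, given by $X|j\rangle = |(j+1) \bmod p\rangle$ and $Z|j\rangle = \omega^{j}|j\rangle$ with $\omega = e^{2\pi i/p}$. Put $d = p^2$ and let $\mathcal{U}$ be the set of the operators $X^mZ^n \otimes X^kZ^l$, $m,n,k,l \in \{0,\dots,p-1\}$, on $\mathbb{C}^p\otimes\mathbb{C}^p \cong \mathbb{C}^{d}$. A maximal commuting class is a set of $d-1$ pairwise commuting elements of $\mathcal{U}\setminus\{I\}$. A set of mutually disjoint maximal commuting classes $\mathcal{C}_1,\dots,\mathcal{C}_N$ is called unextendible if no maximal commuting class is contained in $\mathcal{U}\setminus(\{I\}\cup\bigcup_i \mathcal{C}_i)$. Orthonormal bases $\{a_i\}$ and $\{b_j\}$ of $\mathbb{C}^d$ are mutually unbiased if $|\langle a_i, b_j\rangle| = 1/\sqrt d$ for all $i,j$; a set of MUBs is a set of pairwise mutually unbiased orthonormal bases. A set of MUBs is called weakly unextendible if no orthonormal basis that is a common eigenbasis of a maximal commuting class is unbiased with respect to all of its members. Theorem. For every prime $p$ there is an unextendible set of mutually disjoint maximal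 commuting classes $\mathcal{C}_1,\dots,\mathcal{C}_N$ of cardinality $N = p^2-p+1$ or $N = p^2-p+2$. Each $\mathcal{C}_i$ has a common orthonormal eigenbasis, and whenever $\mathcal{B}_i$ is a common orthonormal eigenbasis of $\mathcal{C}_i$ for $i=1,\dots,N$, the bases $\mathcal{B}_1,\dots,\mathcal{B}_N$ form a weakly unextendible set of $N$ MUBs. -/

import Mathlib

open scoped Kronecker

noncomputable section

namespace UnextMUB

/-! Mutually unbiased bases. The space of dimension `d` is `EuclideanSpace ℂ n` where the index
type `n` has `d` elements; the vectors of an orthonormal basis are labelled by `n` as well. -/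

section General

variable {n : Type*} [Fintype n] [DecidableEq n]

/-- Two orthonormal bases are mutually unbiased: `|⟨a i, b j⟩| = 1 / √d` for all `i`, `j`. -/
def MutuallyUnbiased (a b : OrthonormalBasis n ℂ (EuclideanSpace ℂ n)) : Prop :=
  ∀ i j, ‖inner ℂ (a i) (b j)‖ = 1 / Real.sqrt (Fintype.card n)

/-- A family of orthonormal bases is a set of MUBs if any two of them are mutually unbiased. -/
def IsMUBSet {L : ℕ} (B : Fin L → OrthonormalBasis n ℂ (EuclideanSpace ℂ n)) : Prop :=
  ∀ i j, i ≠ j → MutuallyUnbiased (B i) (B j)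

/-- `C` is a maximal commuting class of operators from `S`: it consists of `d - 1` pairwise
commuting elements of `S` other than the identity. -/
structure IsMaximalCommutingClass (S C : Set (Matrix n n ℂ)) : Prop where
  subset : C ⊆ S \ {1}
  encard : C.encard + 1 = Fintype.card n
  commute : ∀ A ∈ C, ∀ B ∈ C, Commute A B

/-- A family of mutually disjoint maximal commuting classes of operators from `S`. -/
structure IsDisjointMaximalClasses (S : Set (Matrix n n ℂ)) {L : ℕ}
    (C : Fin L → Set (Matrix n n ℂ)) : Prop where
  isClass : ∀ i, IsMaximalCommutingClass S (C i)
  disjoint : ∀ i j, i ≠ j → Disjoint (C i) (C j)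

/-- An unextendible set of classes: mutually disjoint maximal commuting classes such that no
maximal commuting class can be formed out of the remaining operators of `S`. -/
structure IsUnextendibleClasses (S : Set (Matrix n n ℂ)) {L : ℕ}
    (C : Fin L → Set (Matrix n n ℂ)) : Prop where
  classes : IsDisjointMaximalClasses S C
  unextendible : ¬ ∃ D ⊆ S \ ({1} ∪ ⋃ i, C i), IsMaximalCommutingClass S D

/-- The orthonormal basis `b` is a common eigenbasis of the operators in `C`. -/
def IsCommonEigenbasis (C : Set (Matrix n n ℂ))
    (b : OrthonormalBasis n ℂ (EuclideanSpace ℂ n)) : Prop :=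
  ∀ A ∈ C, ∀ j, ∃ μ : ℂ, Matrix.toEuclideanLin A (b j) = μ • b j

/-- A weakly unextendible set of MUBs with respect to the operators in `S`: a set of MUBs for which
no basis unbiased to all of them is a common eigenbasis of a maximal commuting class from `S`. -/
structure IsWeaklyUnextendibleMUBs (S : Set (Matrix n n ℂ)) {L : ℕ}
    (B : Fin L → OrthonormalBasis n ℂ (EuclideanSpace ℂ n)) : Prop where
  mub : IsMUBSet B
  unextendible : ¬ ∃ (D : Set (Matrix n n ℂ)) (b : OrthonormalBasis n ℂ (EuclideanSpace ℂ n)),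
    IsMaximalCommutingClass S D ∧ IsCommonEigenbasis D b ∧ ∀ i, MutuallyUnbiased (B i) b

end General

/-- The shift `X |j⟩ = |j + 1 mod p⟩`. -/
def pauliX (p : ℕ) [NeZero p] : Matrix (ZMod p) (ZMod p) ℂ :=
  Matrix.of fun i j => if i = j + 1 then 1 else 0

/-- The clock `Z |j⟩ = ω ^ j |j⟩`, with `ω = exp (2πi / p)`. -/
def pauliZ (p : ℕ) [NeZero p] : Matrix (ZMod p) (ZMod p) ℂ :=
  Matrix.diagonal fun j => Complex.exp (2 * Real.pi * Complex.I / p) ^ j.val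

/-- The tensor products `X ^ m Z ^ n ⊗ X ^ k Z ^ l` with `0 ≤ m, n, k, l < p`, as operators on
`ℂ^p ⊗ ℂ^p`. -/
def pauliBasis (p : ℕ) [NeZero p] : Set (Matrix (ZMod p × ZMod p) (ZMod p × ZMod p) ℂ) :=
  {U | ∃ m n k l : Fin p, U =
    (pauliX p ^ (m : ℕ) * pauliZ p ^ (n : ℕ)) ⊗ₖ (pauliX p ^ (k : ℕ) * pauliZ p ^ (l : ℕ))}

end UnextMUB

end

/-!
The operators `X ^ m Z ^ n ⊗ X ^ k Z ^ l` are the Weyl operators `weyl u` of the phase space `𝔽_p⁴`;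
two of them commute exactly when the symplectic form of their labels vanishes. Hence the maximal
commuting classes are the Lagrangian planes without `0`
(`IsMaximalCommutingClass.exists_isLagrangian`), disjoint classes are planes meeting only in `0`,
and an unextendible set of classes is a maximal partial spread of Lagrangian planes.

The partial spread comes from a spread by switching. For a polynomial `t ^ 2 - s t - r` without
roots, the graphs of the symmetric matrices `!![a, b; b, r a + s b]` together with the plane `x = 0`
form a spread of `p ^ 2 + 1` planes. The plane `x₂ = y₁ = 0` meets exactly `p + 1` of them, namely
`x = 0` and the graphs with `a = 0`; exchanging these for the new plane leaves `p ^ 2 - p + 1`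
planes. A Lagrangian plane disjoint from all of these has a normal form depending on two parameters
`μ`, `ν` (`exists_normal_form`), and it meets the graph for `(a, b)` as soon as
`(2 μ - s) b - (r + μ ^ 2) a = ν` (`not_disjoint_of_solution`). For `p = 2`, `s = 1` this always has
a solution with `a ≠ 0`, so the partial spread is maximal. For odd `p` and `s = 0` the only
exception is `μ = ν = 0`, the plane `x₁ = y₂ = 0`; with it added, the partial spread of
`p ^ 2 - p + 2` planes is maximal.

The passage to bases uses only that the operators are unitary and orthogonal for the trace form. A
maximal commuting class together with `1` has as many elements as the dimension, so its table of
eigenvalues is square and the orthogonality of its rows gives that of its columns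
(`IsOrthogonalUnitarySystem.exists_completeness`). It follows that eigenbases of disjoint classes
are mutually unbiased, while classes with a common element have no unbiased eigenbases; so a basis
violating weak unextendibility would belong to a class violating unextendibility.
-/

namespace UnextMUB

open Matrix ComplexConjugate

/-! ### Orthogonal systems of unitaries and unbiased bases -/

section UnitarySystem

variable {n : Type*} [Fintype n] [DecidableEq n]

/-- A set of unitary matrices containing the identity that are pairwise orthogonal for the
Hilbert–Schmidt inner product `trace (Aᴴ * B)`. It need not span the space of all matrices. -/
structure IsOrthogonalUnitarySystem (S : Set (Matrix n n ℂ)) : Prop where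
  one_mem : 1 ∈ S
  unitary : ∀ A ∈ S, Aᴴ * A = 1
  orthogonal : ∀ A ∈ S, ∀ B ∈ S, A ≠ B → (Aᴴ * B).trace = 0

/-- The diagonal entry `⟨b j, A b j⟩` of `A` in the orthonormal basis `b`. On a common eigenbasis
this is the eigenvalue of `A` at `b j`. -/
noncomputable def expectation (b : OrthonormalBasis n ℂ (EuclideanSpace ℂ n)) (A : Matrix n n ℂ)
    (j : n) : ℂ :=
  inner ℂ (b j) (toEuclideanLin A (b j))

variable {S C D : Set (Matrix n n ℂ)} {a b : OrthonormalBasis n ℂ (EuclideanSpace ℂ n)}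

lemma sum_expectation (b : OrthonormalBasis n ℂ (EuclideanSpace ℂ n)) (A : Matrix n n ℂ) :
    ∑ j, expectation b A j = A.trace := by
  have h := LinearMap.trace_eq_sum_inner (toEuclideanLin A) b
  rw [toEuclideanLin_eq_toLin_orthonormal, Matrix.trace_toLin_eq] at h
  rw [h, ← toEuclideanLin_eq_toLin_orthonormal]
  rfl

lemma expectation_one (b : OrthonormalBasis n ℂ (EuclideanSpace ℂ n)) (j : n) :
    expectation b 1 j = 1 := by
  simp [expectation]

lemma IsCommonEigenbasis.insert_one (h : IsCommonEigenbasis C b) :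
    IsCommonEigenbasis (insert 1 C) b := by
  rintro A (rfl | hA) j
  · exact ⟨1, by simp⟩
  · exact h A hA j

lemma IsCommonEigenbasis.apply_eq (h : IsCommonEigenbasis C b) {A : Matrix n n ℂ} (hA : A ∈ C)
    (j : n) : toEuclideanLin A (b j) = expectation b A j • b j := by
  obtain ⟨μ, hμ⟩ := h A hA j
  simp [expectation, hμ]

lemma IsCommonEigenbasis.expectation_conjTranspose_mul (h : IsCommonEigenbasis C b)
    {A : Matrix n n ℂ} (hA : A ∈ C) (B : Matrix n n ℂ) (j : n) :
    expectation b (Aᴴ * B) j = conj (expectation b A j) * expectation b B j := by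
  rw [expectation, toLpLin_mul_same, LinearMap.comp_apply,
    toEuclideanLin_conjTranspose_eq_adjoint, LinearMap.adjoint_inner_right, h.apply_eq hA,
    inner_smul_left]
  rfl

lemma IsCommonEigenbasis.expectation_eq_sum (h : IsCommonEigenbasis C b)
    {A : Matrix n n ℂ} (hA : A ∈ C) (a : OrthonormalBasis n ℂ (EuclideanSpace ℂ n)) (j : n) :
    expectation a A j = ∑ k, ((‖inner ℂ (a j) (b k)‖ ^ 2 : ℝ) : ℂ) * expectation b A k := by
  have h1 : toEuclideanLin A (a j) = ∑ k, (inner ℂ (b k) (a j) * expectation b A k) • b k := by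
    conv_lhs => rw [← b.sum_repr' (a j)]
    simp [map_sum, h.apply_eq hA, smul_smul]
  rw [expectation, h1, inner_sum]
  refine Finset.sum_congr rfl fun k _ => ?_
  rw [inner_smul_right, ← inner_conj_symm (b k) (a j), Complex.ofReal_pow, ← Complex.conj_mul']
  ring

/-- Together with the identity, a maximal commuting class has exactly as many elements as the
dimension, so its table of eigenvalues is a square matrix. -/
lemma IsMaximalCommutingClass.exists_finset (hC : IsMaximalCommutingClass S C) :
    ∃ F : Finset (Matrix n n ℂ), (F : Set (Matrix n n ℂ)) = insert 1 C ∧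
      F.card = Fintype.card n := by
  have h1 : (insert 1 C).encard = Fintype.card n := by
    rw [Set.encard_insert_of_notMem fun h => (hC.subset h).2 rfl, hC.encard]
  have hf : (insert 1 C).Finite := Set.finite_of_encard_eq_coe h1
  refine ⟨hf.toFinset, hf.coe_toFinset, ?_⟩
  rw [hf.encard_eq_coe_toFinset_card] at h1
  exact_mod_cast h1

variable (hS : IsOrthogonalUnitarySystem S)
include hS

lemma IsOrthogonalUnitarySystem.insert_one_subset (hC : IsMaximalCommutingClass S C) :
    insert 1 C ⊆ S :=
  Set.insert_subset hS.one_mem (hC.subset.trans Set.sdiff_subset)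

/-- The column orthogonality relations of the eigenvalue table of a maximal commuting class. The row
relations are the trace orthogonality of the operators; as the table is square, they imply the
column relations. -/
lemma IsOrthogonalUnitarySystem.exists_completeness (hC : IsMaximalCommutingClass S C)
    (hb : IsCommonEigenbasis C b) :
    ∃ F : Finset (Matrix n n ℂ), (F : Set (Matrix n n ℂ)) = insert 1 C ∧
      ∀ j k, ∑ A ∈ F, conj (expectation b A k) * expectation b A j =
        if j = k then (Fintype.card n : ℂ) else 0 := by
  obtain ⟨F, hF, hcard⟩ := hC.exists_finset
  refine ⟨F, hF, fun j k => ?_⟩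
  have hd : (Fintype.card n : ℂ) ≠ 0 := by
    have : Nonempty n := ⟨j⟩
    exact_mod_cast Fintype.card_ne_zero
  have hmem : ∀ A : F, (A : Matrix n n ℂ) ∈ insert 1 C := fun A => hF ▸ A.2
  let M : Matrix F n ℂ := Matrix.of fun A i => expectation b A i
  have h1 : M * ((Fintype.card n : ℂ)⁻¹ • Mᴴ) = 1 := by
    ext A B
    have : ∑ i, expectation b A i * conj (expectation b B i) = ((B : Matrix n n ℂ)ᴴ * A).trace := by
      rw [← sum_expectation b]
      refine Finset.sum_congr rfl fun i _ => ?_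
      rw [hb.insert_one.expectation_conjTranspose_mul (hmem B), mul_comm]
    rw [Matrix.mul_smul, Matrix.smul_apply, Matrix.mul_apply]
    simp only [M, Matrix.of_apply, Matrix.conjTranspose_apply]
    simp only [RCLike.star_def, this, Matrix.one_apply]
    split_ifs with h
    · rw [h, hS.unitary B (hS.insert_one_subset hC (hmem B))]
      simp [hd]
    · rw [hS.orthogonal B (hS.insert_one_subset hC (hmem B)) A (hS.insert_one_subset hC (hmem A))
        fun h' => h (Subtype.ext h'.symm)]
      simp
  have h2 := (Matrix.mul_eq_one_comm_of_card_eq _ _ _ (by simp [hcard])).1 h1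
  have h3 := congrFun (congrFun h2 k) j
  rw [Matrix.smul_mul, Matrix.smul_apply, Matrix.mul_apply, smul_eq_mul,
    inv_mul_eq_iff_eq_mul₀ hd] at h3
  simp only [M, Matrix.of_apply, Matrix.conjTranspose_apply, RCLike.star_def] at h3
  rw [← Finset.sum_coe_sort F fun A => conj (expectation b A k) * expectation b A j, h3,
    Matrix.one_apply]
  simp [eq_comm]

/-- By the column relations the projection onto `b j` is a linear combination of `1` and the members
of `C`, all of which are trace orthogonal to `V`. -/
lemma IsOrthogonalUnitarySystem.expectation_eq_zero (hC : IsMaximalCommutingClass S C)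
    (hb : IsCommonEigenbasis C b) {V : Matrix n n ℂ} (hV : V ∈ S) (hVC : V ∉ insert 1 C) (j : n) :
    expectation b V j = 0 := by
  obtain ⟨F, hF, hcomp⟩ := hS.exists_completeness hC hb
  have hd : (Fintype.card n : ℂ) ≠ 0 := by
    have : Nonempty n := ⟨j⟩
    exact_mod_cast Fintype.card_ne_zero
  have h1 : ∑ k, (∑ A ∈ F, conj (expectation b A k) * expectation b A j) * expectation b V k
      = 0 := by
    simp_rw [Finset.sum_mul]
    rw [Finset.sum_comm]
    refine Finset.sum_eq_zero fun A hA => ?_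
    have hA' : A ∈ insert 1 C := hF ▸ hA
    calc _ = expectation b A j * ∑ k, expectation b (Aᴴ * V) k := by
          rw [Finset.mul_sum]
          refine Finset.sum_congr rfl fun k _ => ?_
          rw [hb.insert_one.expectation_conjTranspose_mul hA']
          ring
      _ = 0 := by
          rw [sum_expectation, hS.orthogonal A (hS.insert_one_subset hC hA') V hV
            fun h => hVC (h ▸ hA'), mul_zero]
  simp_rw [hcomp] at h1
  simpa [hd] using h1

/-- Common eigenbases of disjoint maximal commuting classes are mutually unbiased: the members of
`D` have zero expectation in `a`, which by the column relations for `D` forces the probability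
distribution `k ↦ ‖⟨a j, b k⟩‖ ^ 2` to be uniform. -/
lemma IsOrthogonalUnitarySystem.mutuallyUnbiased (hC : IsMaximalCommutingClass S C)
    (hD : IsMaximalCommutingClass S D) (hCD : Disjoint C D)
    (ha : IsCommonEigenbasis C a) (hb : IsCommonEigenbasis D b) : MutuallyUnbiased a b := by
  intro j k
  obtain ⟨F, hF, hcomp⟩ := hS.exists_completeness hD hb
  have hmem : ∀ A ∈ F, A ∈ insert 1 D := fun A hA => hF ▸ hA
  have h1F : (1 : Matrix n n ℂ) ∈ F := by
    have : (1 : Matrix n n ℂ) ∈ (F : Set (Matrix n n ℂ)) := hF ▸ Set.mem_insert 1 D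
    exact this
  have h1 : ∑ i, ((‖inner ℂ (a j) (b i)‖ ^ 2 : ℝ) : ℂ) *
      (∑ A ∈ F, conj (expectation b A k) * expectation b A i) = 1 := by
    simp_rw [Finset.mul_sum]
    rw [Finset.sum_comm]
    have h2 : ∀ A ∈ F, ∑ i, ((‖inner ℂ (a j) (b i)‖ ^ 2 : ℝ) : ℂ) *
        (conj (expectation b A k) * expectation b A i) =
        conj (expectation b A k) * expectation a A j := by
      intro A hA
      rw [hb.insert_one.expectation_eq_sum (hmem A hA) a, Finset.mul_sum]
      exact Finset.sum_congr rfl fun i _ => by ring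
    rw [Finset.sum_congr rfl h2, Finset.sum_eq_single_of_mem 1 h1F]
    · simp [expectation_one]
    · intro A hA hne
      rcases hmem A hA with h | h
      · exact absurd h hne
      rw [hS.expectation_eq_zero hC ha (hS.insert_one_subset hD (hmem A hA)), mul_zero]
      rintro (h' | h')
      · exact hne h'
      · exact Set.disjoint_left.1 hCD h' h
  simp_rw [hcomp] at h1
  have h3 : ‖inner ℂ (a j) (b k)‖ ^ 2 * (Fintype.card n : ℝ) = 1 := by
    have : ((‖inner ℂ (a j) (b k)‖ ^ 2 : ℝ) : ℂ) * (Fintype.card n : ℂ) = 1 := by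
      simpa using h1
    exact_mod_cast this
  have hpos : (0 : ℝ) < Fintype.card n := by
    have : Nonempty n := ⟨j⟩
    exact_mod_cast Fintype.card_pos
  rw [← Real.sqrt_sq (norm_nonneg _), ← Real.sqrt_one, ← Real.sqrt_div zero_le_one]
  congr 1
  rwa [eq_div_iff hpos.ne']

/-- A common element `A` of both classes would have an eigenvalue of modulus one at `a j`, while
unbiasedness makes that eigenvalue the average `trace A / d = 0` of the diagonal of `A`. -/
lemma IsOrthogonalUnitarySystem.disjoint_of_mutuallyUnbiased [Nonempty n]
    (hC : IsMaximalCommutingClass S C)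
    (ha : IsCommonEigenbasis C a) (hb : IsCommonEigenbasis D b) (hab : MutuallyUnbiased a b) :
    Disjoint C D := by
  refine Set.disjoint_left.2 fun A hAC hAD => ?_
  have hAS := hC.subset hAC
  let j : n := Classical.arbitrary n
  have h0 : expectation a A j = 0 := by
    have htr : A.trace = 0 := by
      simpa using hS.orthogonal 1 hS.one_mem A hAS.1 fun h => hAS.2 h.symm
    rw [hb.expectation_eq_sum hAD a j]
    simp_rw [hab j]
    rw [← Finset.mul_sum, sum_expectation, htr, mul_zero]
  have h1 := ha.expectation_conjTranspose_mul hAC A j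
  rw [hS.unitary A hAS.1, expectation_one, h0] at h1
  simp at h1

end UnitarySystem

/-! ### Simultaneous diagonalization of commuting unitaries -/

section Eigenbasis

variable {n : Type*} [Fintype n] [DecidableEq n]

lemma exists_isCommonEigenbasis {C : Set (Matrix n n ℂ)} (hu : ∀ A ∈ C, Aᴴ * A = 1)
    (hc : ∀ A ∈ C, ∀ B ∈ C, Commute A B) :
    ∃ b : OrthonormalBasis n ℂ (EuclideanSpace ℂ n), IsCommonEigenbasis C b := by
  classical
  have hc' : ∀ A ∈ C, ∀ B ∈ C, Commute Aᴴ B := fun A hA B hB => by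
    have h1 := hu A hA
    have h2 : A * Aᴴ = 1 := mul_eq_one_comm.1 h1
    calc Aᴴ * B = Aᴴ * (B * A) * Aᴴ := by
          rw [mul_assoc, mul_assoc, h2, mul_one]
      _ = B * Aᴴ := by
          rw [← (hc A hA B hB).eq, ← mul_assoc, h1, one_mul]
  have hcc : ∀ A ∈ C, ∀ B ∈ C, Commute Aᴴ Bᴴ := fun A hA B hB => by
    have := congrArg conjTranspose (hc B hB A hA).eq
    simpa [Commute, SemiconjBy] using this
  -- The hermitian and antihermitian parts of the members of `C` form a commuting family of
  -- symmetric operators, to which simultaneous diagonalization applies.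
  let T : C × Bool → Matrix n n ℂ := fun i =>
    if i.2 then (i.1 : Matrix n n ℂ) + (i.1 : Matrix n n ℂ)ᴴ
    else Complex.I • ((i.1 : Matrix n n ℂ) - (i.1 : Matrix n n ℂ)ᴴ)
  have hsymm : ∀ i, (toEuclideanLin (T i)).IsSymmetric := by
    rintro ⟨A, s⟩
    rw [isSymmetric_toEuclideanLin_iff]
    cases s
    · simp [T, Matrix.IsHermitian, conjTranspose_smul, ← smul_neg]
    · simp [T, Matrix.IsHermitian, add_comm]
  have hcomm : ∀ i j, Commute (T i) (T j) := by
    have hAB : ∀ A ∈ C, ∀ B ∈ C, Commute A Bᴴ := fun A hA B hB => (hc' B hB A hA).symm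
    rintro ⟨⟨A, hA⟩, s⟩ ⟨⟨B, hB⟩, t⟩
    have h1 := hc A hA B hB
    have h2 := hc' A hA B hB
    have h3 := hcc A hA B hB
    have h4 := hAB A hA B hB
    have hadd : ∀ X : Matrix n n ℂ, Commute X B → Commute X Bᴴ →
        Commute X (T ⟨⟨B, hB⟩, t⟩) := by
      intro X hX hX'
      cases t
      · exact (hX.sub_right hX').smul_right _
      · exact hX.add_right hX'
    have hA1 := hadd A h1 h4
    have hA2 := hadd Aᴴ h2 h3
    cases s
    · exact (hA1.sub_left hA2).smul_left _
    · exact hA1.add_left hA2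
  have hcomm' : Pairwise (Function.onFun Commute fun i => toEuclideanLin (T i)) := by
    intro i j _
    change _ * _ = _ * _
    rw [Module.End.mul_eq_comp, Module.End.mul_eq_comp, ← toLpLin_mul_same, ← toLpLin_mul_same,
      (hcomm i j).eq]
  have htop := LinearMap.IsSymmetric.iSup_iInf_eq_top_of_commute hsymm hcomm'
  have horth := LinearMap.IsSymmetric.orthogonalFamily_iInf_eigenspaces hsymm
  let V : (C × Bool → ℂ) → Submodule ℂ (EuclideanSpace ℂ n) := fun χ =>
    ⨅ i, Module.End.eigenspace (toEuclideanLin (T i)) (χ i)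
  -- Only finitely many joint eigenspaces are nonzero; the others are dropped, as a subordinate
  -- basis needs a finite index type.
  have hfin : Finite {χ // V χ ≠ ⊥} := WellFoundedGT.finite_ne_bot_of_iSupIndep horth.independent
  have := Fintype.ofFinite {χ // V χ ≠ ⊥}
  have horth' : OrthogonalFamily ℂ (fun χ : {χ // V χ ≠ ⊥} => V χ)
      fun χ => (V χ).subtypeₗᵢ := horth.comp Subtype.val_injective
  have hint : DirectSum.IsInternal fun χ : {χ // V χ ≠ ⊥} => V χ := by
    rw [OrthogonalFamily.isInternal_iff horth', iSup_ne_bot_subtype]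
    exact (congrArg _ htop).trans Submodule.top_orthogonal_eq_bot
  have hn : Module.finrank ℂ (EuclideanSpace ℂ n) = Fintype.card n := finrank_euclideanSpace
  refine ⟨(hint.subordinateOrthonormalBasis hn horth').reindex (Fintype.equivFin n).symm,
    fun A hA j => ?_⟩
  rw [OrthonormalBasis.reindex_apply]
  set k := (Fintype.equivFin n).symm.symm j
  have hmem := hint.subordinateOrthonormalBasis_subordinate hn k horth'
  set v := hint.subordinateOrthonormalBasis hn horth' k
  set χ := hint.subordinateOrthonormalBasisIndex hn k horth'
  have hev := fun i => Module.End.mem_eigenspace_iff.1 (Submodule.mem_iInf _ |>.1 hmem i)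
  have h1 := hev (⟨A, hA⟩, true)
  have h2 := hev (⟨A, hA⟩, false)
  -- `A` is recovered from its hermitian and antihermitian parts.
  have hA2 : A = (2⁻¹ : ℂ) • (T (⟨A, hA⟩, true) - Complex.I • T (⟨A, hA⟩, false)) := by
    ext i j
    simp only [T, Matrix.smul_apply, Matrix.sub_apply, Matrix.add_apply, smul_eq_mul, if_true,
      Bool.false_eq_true, if_false]
    linear_combination ((2⁻¹ : ℂ) * (A i j - Aᴴ i j)) * Complex.I_mul_I
  refine ⟨2⁻¹ * (χ.1 (⟨A, hA⟩, true) - Complex.I * χ.1 (⟨A, hA⟩, false)), ?_⟩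
  conv_lhs => rw [hA2]
  rw [map_smul, map_sub, map_smul, LinearMap.smul_apply, LinearMap.sub_apply, LinearMap.smul_apply,
    h1, h2, smul_smul, ← sub_smul, smul_smul]

end Eigenbasis

/-! ### The tensor products of Pauli operators as Weyl operators -/

section Weyl

/-- The phase space `𝔽_p² × 𝔽_p²`: the first component holds the two exponents of `X` (shifts), the
second one the two exponents of `Z` (phases). -/
abbrev PhaseSpace (p : ℕ) : Type := (ZMod p × ZMod p) × (ZMod p × ZMod p)

/-- The standard bilinear form on `𝔽_p²`. -/
def dot {p : ℕ} (a b : ZMod p × ZMod p) : ZMod p := a.1 * b.1 + a.2 * b.2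

variable {p : ℕ} [NeZero p]

/-- The Weyl operator `|j⟩ ↦ ω ^ (y ⬝ j) |j + x⟩` on `ℂ^p ⊗ ℂ^p` attached to the phase space point
`u = (x, y)`. -/
noncomputable def weyl (u : PhaseSpace p) : Matrix (ZMod p × ZMod p) (ZMod p × ZMod p) ℂ :=
  Matrix.of fun i j => if i = j + u.1 then ZMod.stdAddChar (dot u.2 j) else 0

lemma pauliX_pow_apply (m : ℕ) (i j : ZMod p) :
    (pauliX p ^ m) i j = if i = j + m then 1 else 0 := by
  induction m generalizing j with
  | zero => simp [Matrix.one_apply]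
  | succ m ih =>
    rw [pow_succ, Matrix.mul_apply]
    have h : ∀ x, pauliX p x j = if x = j + 1 then 1 else 0 := fun x => rfl
    simp only [ih, h, mul_ite, mul_one, mul_zero, Finset.sum_ite_eq', Finset.mem_univ, if_true]
    push_cast
    rw [add_assoc, add_comm (1 : ZMod p)]

lemma exp_pow_val (j : ZMod p) :
    Complex.exp (2 * Real.pi * Complex.I / p) ^ j.val = ZMod.stdAddChar j := by
  have h := ZMod.stdAddChar_coe (N := p) (j.val : ℤ)
  rw [show (((j.val : ℤ) : ZMod p)) = j by simp] at h
  rw [h, ← Complex.exp_nat_mul]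
  congr 1
  push_cast
  ring

lemma pauliX_pow_mul_pauliZ_pow_apply (m k : ℕ) (i j : ZMod p) :
    (pauliX p ^ m * pauliZ p ^ k) i j =
      if i = j + m then ZMod.stdAddChar ((k : ZMod p) * j) else 0 := by
  rw [pauliZ, Matrix.diagonal_pow, Matrix.mul_diagonal, pauliX_pow_apply, Pi.pow_apply,
    exp_pow_val, ← nsmul_eq_mul, AddChar.map_nsmul_eq_pow]
  split_ifs <;> simp

lemma kronecker_eq_weyl (m n k l : ℕ) :
    (pauliX p ^ m * pauliZ p ^ n) ⊗ₖ (pauliX p ^ k * pauliZ p ^ l) =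
      weyl (((m : ZMod p), (k : ZMod p)), ((n : ZMod p), (l : ZMod p))) := by
  ext ⟨i, i'⟩ ⟨j, j'⟩
  rw [Matrix.kroneckerMap_apply, pauliX_pow_mul_pauliZ_pow_apply, pauliX_pow_mul_pauliZ_pow_apply]
  simp only [weyl, dot, Matrix.of_apply, Prod.mk_add_mk, Prod.mk.injEq, AddChar.map_add_eq_mul]
  split_ifs <;> simp_all

lemma pauliBasis_eq_range : pauliBasis p = Set.range (weyl (p := p)) := by
  ext U
  constructor
  · rintro ⟨m, n, k, l, rfl⟩
    exact ⟨_, (kronecker_eq_weyl _ _ _ _).symm⟩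
  · rintro ⟨⟨⟨m, k⟩, ⟨n, l⟩⟩, rfl⟩
    refine ⟨⟨m.val, m.val_lt⟩, ⟨n.val, n.val_lt⟩, ⟨k.val, k.val_lt⟩, ⟨l.val, l.val_lt⟩, ?_⟩
    rw [kronecker_eq_weyl]
    simp

lemma weyl_zero : weyl (0 : PhaseSpace p) = 1 := by
  ext i j
  simp [weyl, dot, Matrix.one_apply]

lemma weyl_mul (u v : PhaseSpace p) :
    weyl u * weyl v = ZMod.stdAddChar (dot u.2 v.1) • weyl (u + v) := by
  ext i j
  rw [Matrix.mul_apply]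
  simp only [weyl, Matrix.of_apply, mul_ite, mul_zero, Matrix.smul_apply, smul_eq_mul]
  rw [Finset.sum_ite_eq' Finset.univ (j + v.1)]
  simp only [Finset.mem_univ, if_true, Prod.fst_add, Prod.snd_add, ite_mul, zero_mul, add_assoc,
    add_comm v.1 u.1, ← AddChar.map_add_eq_mul]
  congr 2
  simp only [dot, Prod.fst_add, Prod.snd_add]
  ring

lemma conj_stdAddChar (x : ZMod p) :
    conj (ZMod.stdAddChar x : ℂ) = ZMod.stdAddChar (-x) := by
  rw [AddChar.map_neg_eq_conj]

lemma weyl_unitary (u : PhaseSpace p) : (weyl u)ᴴ * weyl u = 1 := by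
  ext i j
  rw [Matrix.mul_apply, Matrix.one_apply]
  simp only [weyl, Matrix.conjTranspose_apply, Matrix.of_apply, mul_ite, mul_zero]
  rw [Finset.sum_ite_eq' Finset.univ (j + u.1)]
  simp only [Finset.mem_univ, if_true, add_left_inj, RCLike.star_def]
  by_cases h : i = j
  · subst h
    simp [conj_stdAddChar, ← AddChar.map_add_eq_mul]
  · simp [h, Ne.symm h]

lemma sum_stdAddChar_dot {y : ZMod p × ZMod p} (hy : y ≠ 0) :
    ∑ j : ZMod p × ZMod p, (ZMod.stdAddChar (dot y j) : ℂ) = 0 := by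
  rw [Fintype.sum_prod_type]
  simp only [dot, AddChar.map_add_eq_mul, ← Finset.mul_sum, ← Finset.sum_mul]
  have h := fun x : ZMod p => AddChar.sum_mulShift x (ZMod.isPrimitive_stdAddChar p)
  simp only [mul_comm y.1, mul_comm y.2, h]
  by_contra hne
  apply hy
  ext <;> by_contra h0 <;> simp_all

lemma trace_weyl {u : PhaseSpace p} (hu : u ≠ 0) : (weyl u).trace = 0 := by
  simp only [Matrix.trace, Matrix.diag_apply, weyl, Matrix.of_apply, left_eq_add]
  by_cases h : u.1 = 0
  · simp only [h, if_true]
    exact sum_stdAddChar_dot fun h2 => hu (Prod.ext h h2)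
  · simp [h]

lemma weyl_conjTranspose (u : PhaseSpace p) :
    (weyl u)ᴴ = ZMod.stdAddChar (dot u.2 u.1) • weyl (-u) := by
  have h1 : weyl u * (ZMod.stdAddChar (dot u.2 u.1) • weyl (-u)) = 1 := by
    rw [Matrix.mul_smul, weyl_mul, add_neg_cancel, weyl_zero, smul_smul, ← AddChar.map_add_eq_mul]
    rw [show dot u.2 u.1 + dot u.2 (-u).1 = 0 by simp only [dot, Prod.fst_neg, Prod.snd_neg]; ring,
      AddChar.map_zero_eq_one, one_smul]
  calc (weyl u)ᴴ = (weyl u)ᴴ * (weyl u * (ZMod.stdAddChar (dot u.2 u.1) • weyl (-u))) := by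
        rw [h1, mul_one]
    _ = _ := by rw [← mul_assoc, weyl_unitary, one_mul]

lemma trace_conjTranspose_weyl_mul {u v : PhaseSpace p} (h : u ≠ v) :
    ((weyl u)ᴴ * weyl v).trace = 0 := by
  rw [weyl_conjTranspose, Matrix.smul_mul, weyl_mul, Matrix.trace_smul, Matrix.trace_smul,
    trace_weyl, smul_zero, smul_zero]
  rwa [neg_add_eq_sub, sub_ne_zero, ne_comm]

lemma weyl_ne_zero (u : PhaseSpace p) : weyl u ≠ 0 := fun h => by
  have := weyl_unitary u
  simp [h] at this

lemma weyl_injective : Function.Injective (weyl (p := p)) := fun u v h => by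
  by_contra hne
  have h1 := trace_conjTranspose_weyl_mul hne
  rw [h, weyl_unitary, Matrix.trace_one] at h1
  exact Fintype.card_ne_zero (α := ZMod p × ZMod p) (by exact_mod_cast h1)

lemma isOrthogonalUnitarySystem_pauliBasis : IsOrthogonalUnitarySystem (pauliBasis p) := by
  rw [pauliBasis_eq_range]
  refine ⟨⟨0, weyl_zero⟩, ?_, ?_⟩
  · rintro _ ⟨u, rfl⟩
    exact weyl_unitary u
  · rintro _ ⟨u, rfl⟩ _ ⟨v, rfl⟩ h
    exact trace_conjTranspose_weyl_mul fun h' => h (h' ▸ rfl)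

lemma commute_weyl_iff {u v : PhaseSpace p} :
    Commute (weyl u) (weyl v) ↔ dot u.2 v.1 = dot v.2 u.1 := by
  rw [Commute, SemiconjBy, weyl_mul, weyl_mul, add_comm v u,
    (smul_left_injective ℂ (weyl_ne_zero (u + v))).eq_iff, ZMod.injective_stdAddChar.eq_iff]

end Weyl

/-! ### Maximal commuting classes and Lagrangian planes -/

section Lagrangian

variable {p : ℕ} [Fact p.Prime]

/-- A Lagrangian plane: a two-dimensional subspace of phase space on which the symplectic form
`dot u.2 v.1 - dot v.2 u.1` vanishes. -/
structure IsLagrangian (L : Submodule (ZMod p) (PhaseSpace p)) : Prop where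
  isotropic : ∀ u ∈ L, ∀ v ∈ L, dot u.2 v.1 = dot v.2 u.1
  finrank_eq : Module.finrank (ZMod p) L = 2

/-- The symplectic form on phase space; it vanishes exactly when the Weyl operators commute. -/
def symplecticForm (p : ℕ) : LinearMap.BilinForm (ZMod p) (PhaseSpace p) :=
  LinearMap.mk₂ (ZMod p) (fun u v => dot u.2 v.1 - dot v.2 u.1)
    (by intros; simp only [dot, Prod.fst_add, Prod.snd_add]; ring)
    (by intros; simp only [dot, Prod.smul_fst, Prod.smul_snd, smul_eq_mul]; ring)
    (by intros; simp only [dot, Prod.fst_add, Prod.snd_add]; ring)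
    (by intros; simp only [dot, Prod.smul_fst, Prod.smul_snd, smul_eq_mul]; ring)

lemma symplecticForm_apply (u v : PhaseSpace p) :
    symplecticForm p u v = dot u.2 v.1 - dot v.2 u.1 := rfl

lemma symplecticForm_nondegenerate : (symplecticForm p).Nondegenerate := by
  have h : ∀ u : PhaseSpace p, (∀ v, symplecticForm p u v = 0) → u = 0 := by
    intro u hu
    have h1 := hu ((1, 0), (0, 0))
    have h2 := hu ((0, 1), (0, 0))
    have h3 := hu ((0, 0), (1, 0))
    have h4 := hu ((0, 0), (0, 1))
    simp [symplecticForm_apply, dot] at h1 h2 h3 h4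
    ext <;> assumption
  refine ⟨h, fun v hv => h v fun u => ?_⟩
  have := hv u
  rw [symplecticForm_apply] at this ⊢
  linear_combination -this

lemma finrank_le_two_of_isotropic {L : Submodule (ZMod p) (PhaseSpace p)}
    (hL : ∀ u ∈ L, ∀ v ∈ L, dot u.2 v.1 = dot v.2 u.1) : Module.finrank (ZMod p) L ≤ 2 := by
  have h1 : L ≤ (symplecticForm p).orthogonal L := fun v hv u hu => by
    rw [symplecticForm_apply, hL u hu v hv, sub_self]
  have h2 := Submodule.finrank_mono h1
  rw [LinearMap.BilinForm.finrank_orthogonal symplecticForm_nondegenerate] at h2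
  have h3 : Module.finrank (ZMod p) (PhaseSpace p) = 4 := by simp [PhaseSpace]
  omega

lemma encard_submodule (L : Submodule (ZMod p) (PhaseSpace p)) :
    (L : Set (PhaseSpace p)).encard = (p ^ Module.finrank (ZMod p) L : ℕ) := by
  have h := Module.natCard_eq_pow_finrank (K := ZMod p) (V := L)
  rw [Nat.card_zmod] at h
  rw [← h, ← (Set.toFinite (L : Set (PhaseSpace p))).cast_ncard_eq]
  rfl

lemma card_index : Fintype.card (ZMod p × ZMod p) = p ^ 2 := by
  rw [Fintype.card_prod, ZMod.card, sq]

/-- The set of Weyl operators attached to the nonzero points of `L`. -/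
noncomputable def weylClass (L : Submodule (ZMod p) (PhaseSpace p)) :
    Set (Matrix (ZMod p × ZMod p) (ZMod p × ZMod p) ℂ) :=
  weyl '' ((L : Set (PhaseSpace p)) \ {0})

lemma IsLagrangian.isMaximalCommutingClass {L : Submodule (ZMod p) (PhaseSpace p)}
    (hL : IsLagrangian L) : IsMaximalCommutingClass (pauliBasis p) (weylClass L) where
  subset := by
    rintro _ ⟨u, ⟨_, hu⟩, rfl⟩
    rw [pauliBasis_eq_range]
    exact ⟨⟨u, rfl⟩, fun h => hu (weyl_injective (h.trans weyl_zero.symm))⟩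
  encard := by
    rw [weylClass, weyl_injective.encard_image, Set.encard_sdiff_singleton_add_one L.zero_mem,
      encard_submodule, hL.finrank_eq, card_index]
  commute := by
    rintro _ ⟨u, ⟨hu, _⟩, rfl⟩ _ ⟨v, ⟨hv, _⟩, rfl⟩
    exact commute_weyl_iff.2 (hL.isotropic u hu v hv)

/-- Every maximal commuting class comes from a Lagrangian plane: its `p ^ 2 - 1` points and `0` span
an isotropic subspace, which has at most `p ^ 2` points and so is no larger than the set. -/
lemma IsMaximalCommutingClass.exists_isLagrangian
    {D : Set (Matrix (ZMod p × ZMod p) (ZMod p × ZMod p) ℂ)}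
    (hD : IsMaximalCommutingClass (pauliBasis p) D) : ∃ L, IsLagrangian L ∧ weylClass L = D := by
  set T : Set (PhaseSpace p) := weyl ⁻¹' insert 1 D
  have hsub : insert 1 D ⊆ Set.range (weyl (p := p)) := by
    rw [← pauliBasis_eq_range]
    exact isOrthogonalUnitarySystem_pauliBasis.insert_one_subset hD
  have himage : weyl '' T = insert 1 D := Set.image_preimage_eq_of_subset hsub
  have hT : T.encard = (p ^ 2 : ℕ) := by
    rw [← weyl_injective.encard_image, himage,
      Set.encard_insert_of_notMem fun h => (hD.subset h).2 rfl, hD.encard, card_index]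
  have hiso : ∀ u ∈ T, ∀ v ∈ T, symplecticForm p u v = 0 := by
    intro u hu v hv
    rw [symplecticForm_apply, sub_eq_zero, ← commute_weyl_iff]
    rcases hu with hu | hu
    · rw [hu]
      exact Commute.one_left _
    rcases hv with hv | hv
    · rw [hv]
      exact Commute.one_right _
    exact hD.commute _ hu _ hv
  have hspan : ∀ u ∈ Submodule.span (ZMod p) T, ∀ v ∈ Submodule.span (ZMod p) T,
      dot u.2 v.1 = dot v.2 u.1 := by
    intro u hu v hv
    rw [← sub_eq_zero, ← symplecticForm_apply]
    induction hu, hv using Submodule.span_induction₂ with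
    | mem_mem x y hx hy => exact hiso x hx y hy
    | zero_left => simp
    | zero_right => simp
    | add_left _ _ _ _ _ _ h1 h2 => rw [map_add, LinearMap.add_apply, h1, h2, add_zero]
    | add_right _ _ _ _ _ _ h1 h2 => rw [map_add, h1, h2, add_zero]
    | smul_left _ _ _ _ _ h => rw [map_smul, LinearMap.smul_apply, h, smul_zero]
    | smul_right _ _ _ _ _ h => rw [map_smul, h, smul_zero]
  have hle := finrank_le_two_of_isotropic hspan
  have hp := (Fact.out : p.Prime).one_lt
  have heq : T = Submodule.span (ZMod p) T := by
    refine (Set.toFinite _).eq_of_subset_of_encard_le Submodule.subset_span ?_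
    rw [hT, encard_submodule]
    exact_mod_cast Nat.pow_le_pow_right hp.le hle
  refine ⟨Submodule.span (ZMod p) T, ⟨hspan, ?_⟩, ?_⟩
  · have h1 := encard_submodule (Submodule.span (ZMod p) T)
    rw [← heq, hT] at h1
    exact (Nat.pow_right_injective hp (by exact_mod_cast h1)).symm
  · rw [weylClass, ← heq, Set.image_sdiff weyl_injective, himage, Set.image_singleton, weyl_zero]
    exact Set.insert_sdiff_self_of_notMem fun h => (hD.subset h).2 rfl

lemma disjoint_weylClass_iff {L M : Submodule (ZMod p) (PhaseSpace p)} :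
    Disjoint (weylClass L) (weylClass M) ↔ Disjoint L M := by
  rw [weylClass, weylClass, Set.disjoint_image_iff weyl_injective, Submodule.disjoint_def,
    Set.disjoint_left]
  constructor
  · intro h u hu hu'
    by_contra h0
    exact h ⟨hu, h0⟩ ⟨hu', h0⟩
  · rintro h u ⟨hu, h0⟩ ⟨hu', _⟩
    exact h0 (h u hu hu')

/-- There is an unextendible family of `N` maximal commuting classes of Pauli operators that have
common eigenbases, and any choice of common eigenbases is a weakly unextendible set of MUBs. -/
def HasUnextendibleClasses (p N : ℕ) [Fact p.Prime] : Prop :=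
  ∃ C : Fin N → Set (Matrix (ZMod p × ZMod p) (ZMod p × ZMod p) ℂ),
    IsUnextendibleClasses (pauliBasis p) C ∧
    (∀ i, ∃ b : OrthonormalBasis (ZMod p × ZMod p) ℂ (EuclideanSpace ℂ (ZMod p × ZMod p)),
      IsCommonEigenbasis (C i) b) ∧
    ∀ B : Fin N → OrthonormalBasis (ZMod p × ZMod p) ℂ (EuclideanSpace ℂ (ZMod p × ZMod p)),
      (∀ i, IsCommonEigenbasis (C i) (B i)) → IsWeaklyUnextendibleMUBs (pauliBasis p) B

/-- A maximal partial spread of Lagrangian planes, that is, a family of pairwise disjoint planes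
such that no further plane is disjoint from all of them, gives an unextendible family of classes. -/
lemma hasUnextendibleClasses_of_maximal_partial_spread {ι : Type*} [Fintype ι]
    (L : ι → Submodule (ZMod p) (PhaseSpace p)) (hL : ∀ i, IsLagrangian (L i))
    (hdisj : Pairwise (Function.onFun Disjoint L))
    (hmax : ∀ M, IsLagrangian M → ¬ ∀ i, Disjoint M (L i)) :
    HasUnextendibleClasses p (Fintype.card ι) := by
  have hS := isOrthogonalUnitarySystem_pauliBasis (p := p)
  let e := Fintype.equivFin ι
  have hclass : ∀ i, IsMaximalCommutingClass (pauliBasis p) (weylClass (L (e.symm i))) :=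
    fun i => (hL _).isMaximalCommutingClass
  have hcd : ∀ i j, i ≠ j → Disjoint (weylClass (L (e.symm i))) (weylClass (L (e.symm j))) :=
    fun i j hij => disjoint_weylClass_iff.2 (hdisj fun h => hij (e.symm.injective h))
  have hno : ∀ D, IsMaximalCommutingClass (pauliBasis p) D →
      ¬ ∀ i, Disjoint (weylClass (L (e.symm i))) D := by
    intro D hD h
    obtain ⟨M, hM, rfl⟩ := hD.exists_isLagrangian
    refine hmax M hM fun i => (disjoint_weylClass_iff.1 ?_).symm
    simpa using h (e i)
  refine ⟨fun i => weylClass (L (e.symm i)), ⟨⟨hclass, hcd⟩, ?_⟩, fun i => ?_, fun B hB =>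
    ⟨fun i j hij => ?_, ?_⟩⟩
  · rintro ⟨D, hsub, hD⟩
    refine hno D hD fun i => Set.disjoint_left.2 fun A hA hAD => (hsub hAD).2 (Or.inr ?_)
    exact Set.mem_iUnion.2 ⟨i, hA⟩
  · exact exists_isCommonEigenbasis (fun A hA => hS.unitary A ((hclass i).subset hA).1)
      (hclass i).commute
  · exact hS.mutuallyUnbiased (hclass i) (hclass j) (hcd i j hij) (hB i) (hB j)
  · rintro ⟨D, b, hD, hb, hub⟩
    exact hno D hD fun i => hS.disjoint_of_mutuallyUnbiased (hclass i) (hB i) hb (hub i)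

end Lagrangian

/-! ### A maximal partial spread of Lagrangian planes -/

section Spread

variable {p : ℕ} [Fact p.Prime]

lemma isLagrangian_range (f : ZMod p × ZMod p →ₗ[ZMod p] PhaseSpace p)
    (hf : Function.Injective f) (hiso : ∀ v w, dot (f v).2 (f w).1 = dot (f w).2 (f v).1) :
    IsLagrangian (LinearMap.range f) where
  isotropic := by
    rintro _ ⟨v, rfl⟩ _ ⟨w, rfl⟩
    exact hiso v w
  finrank_eq := by simp [LinearMap.finrank_range_of_inj hf]

/-- The parametrization `x ↦ (x, A x)` of the graph of the symmetric matrix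
`A = !![a, b; b, r * a + s * b]`. -/
def graphMap (r s a b : ZMod p) : ZMod p × ZMod p →ₗ[ZMod p] PhaseSpace p where
  toFun v := (v, (a * v.1 + b * v.2, b * v.1 + (r * a + s * b) * v.2))
  map_add' v w := by ext <;> simp <;> ring
  map_smul' c v := by ext <;> simp <;> ring

/-- The parametrization of the plane `x₂ = 0`, `y₁ = 0`. -/
def switchedMap (p : ℕ) : ZMod p × ZMod p →ₗ[ZMod p] PhaseSpace p where
  toFun v := ((v.1, 0), (0, v.2))
  map_add' v w := by ext <;> simp
  map_smul' c v := by ext <;> simp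

/-- The parametrization of the plane `x₁ = 0`, `y₂ = 0`. -/
def oppositeMap (p : ℕ) : ZMod p × ZMod p →ₗ[ZMod p] PhaseSpace p where
  toFun v := ((0, v.1), (v.2, 0))
  map_add' v w := by ext <;> simp
  map_smul' c v := by ext <;> simp

/-- The plane `{(x, A x)}` for `A = !![a, b; b, r * a + s * b]`. If `t ^ 2 - s * t - r` has no root,
these planes and `{x = 0}` form a spread. -/
def graphPlane (r s a b : ZMod p) : Submodule (ZMod p) (PhaseSpace p) :=
  LinearMap.range (graphMap r s a b)

/-- The plane `x₂ = 0`, `y₁ = 0`. Of the spread it meets only the plane `x = 0` and the graph planes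
with `a = 0`, and it replaces these `p + 1` planes. -/
def switchedPlane (p : ℕ) : Submodule (ZMod p) (PhaseSpace p) := LinearMap.range (switchedMap p)

/-- The plane `x₁ = 0`, `y₂ = 0`. For `s = 0` it meets the same planes of the spread as
`switchedPlane`, so that it can be added as well. -/
def oppositePlane (p : ℕ) : Submodule (ZMod p) (PhaseSpace p) := LinearMap.range (oppositeMap p)

lemma mem_graphPlane {r s a b : ZMod p} {u : PhaseSpace p} :
    u ∈ graphPlane r s a b ↔ u.2.1 = a * u.1.1 + b * u.1.2 ∧
      u.2.2 = b * u.1.1 + (r * a + s * b) * u.1.2 := by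
  constructor
  · rintro ⟨v, rfl⟩
    exact ⟨rfl, rfl⟩
  · rintro ⟨h1, h2⟩
    exact ⟨u.1, Prod.ext rfl (Prod.ext h1.symm h2.symm)⟩

lemma mem_switchedPlane {u : PhaseSpace p} :
    u ∈ switchedPlane p ↔ u.1.2 = 0 ∧ u.2.1 = 0 := by
  constructor
  · rintro ⟨v, rfl⟩
    exact ⟨rfl, rfl⟩
  · rintro ⟨h1, h2⟩
    exact ⟨(u.1.1, u.2.2), Prod.ext (Prod.ext rfl h1.symm) (Prod.ext h2.symm rfl)⟩

lemma mem_oppositePlane {u : PhaseSpace p} :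
    u ∈ oppositePlane p ↔ u.1.1 = 0 ∧ u.2.2 = 0 := by
  constructor
  · rintro ⟨v, rfl⟩
    exact ⟨rfl, rfl⟩
  · rintro ⟨h1, h2⟩
    exact ⟨(u.1.2, u.2.1), Prod.ext (Prod.ext h1.symm rfl) (Prod.ext rfl h2.symm)⟩

lemma isLagrangian_graphPlane (r s a b : ZMod p) : IsLagrangian (graphPlane r s a b) := by
  refine isLagrangian_range _ (fun v w h => congrArg Prod.fst h) fun v w => ?_
  simp only [graphMap, dot, LinearMap.coe_mk, AddHom.coe_mk]
  ring

lemma isLagrangian_switchedPlane : IsLagrangian (switchedPlane p) := by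
  refine isLagrangian_range _ (fun v w h => ?_) fun v w => by simp [switchedMap, dot]
  exact Prod.ext (congrArg (fun u => u.1.1) h) (congrArg (fun u => u.2.2) h)

lemma isLagrangian_oppositePlane : IsLagrangian (oppositePlane p) := by
  refine isLagrangian_range _ (fun v w h => ?_) fun v w => by simp [oppositeMap, dot]
  exact Prod.ext (congrArg (fun u => u.1.2) h) (congrArg (fun u => u.2.1) h)

/-- The determinant of a difference of two of the symmetric matrices is the value of an anisotropic
binary quadratic form, hence nonzero. -/
lemma disjoint_graphPlane {r s : ZMod p}
    (haniso : ∀ a b, r * a ^ 2 + s * a * b - b ^ 2 = 0 → a = 0 ∧ b = 0) {a b a' b' : ZMod p}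
    (hne : ¬(a = a' ∧ b = b')) : Disjoint (graphPlane r s a b) (graphPlane r s a' b') := by
  rw [Submodule.disjoint_def]
  rintro ⟨⟨x, y⟩, ⟨z, t⟩⟩ h h'
  rw [mem_graphPlane] at h h'
  simp only at h h'
  have hdet : r * (a - a') ^ 2 + s * (a - a') * (b - b') - (b - b') ^ 2 ≠ 0 := fun h0 =>
    hne ((haniso _ _ h0).imp sub_eq_zero.1 sub_eq_zero.1)
  have h1 : (a - a') * x + (b - b') * y = 0 := by linear_combination h'.1 - h.1
  have h2 : (b - b') * x + (r * (a - a') + s * (b - b')) * y = 0 := by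
    linear_combination h'.2 - h.2
  have hx : x = 0 := by
    refine (mul_eq_zero.1 ?_).resolve_left hdet
    linear_combination (r * (a - a') + s * (b - b')) * h1 - (b - b') * h2
  have hy : y = 0 := by
    refine (mul_eq_zero.1 ?_).resolve_left hdet
    linear_combination (a - a') * h2 - (b - b') * h1
  subst hx hy
  simp [h.1, h.2]

lemma disjoint_graphPlane_switchedPlane {r s a b : ZMod p} (ha : a ≠ 0) :
    Disjoint (graphPlane r s a b) (switchedPlane p) := by
  rw [Submodule.disjoint_def]
  rintro ⟨⟨x, y⟩, ⟨z, t⟩⟩ h h'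
  rw [mem_graphPlane] at h
  rw [mem_switchedPlane] at h'
  obtain ⟨rfl, rfl⟩ := h'
  obtain ⟨h1, h2⟩ := h
  simp only at h1 h2
  have hx : x = 0 := by simpa [ha, eq_comm] using h1
  simp [h2, hx]

lemma disjoint_graphPlane_oppositePlane {r a b : ZMod p} (hr : r ≠ 0) (ha : a ≠ 0) :
    Disjoint (graphPlane r 0 a b) (oppositePlane p) := by
  rw [Submodule.disjoint_def]
  rintro ⟨⟨x, y⟩, ⟨z, t⟩⟩ h h'
  rw [mem_graphPlane] at h
  rw [mem_oppositePlane] at h'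
  obtain ⟨rfl, rfl⟩ := h'
  obtain ⟨h1, h2⟩ := h
  simp only at h1 h2
  have hy : y = 0 := by simpa [hr, ha, eq_comm] using h2
  simp [h1, hy]

lemma disjoint_switchedPlane_oppositePlane : Disjoint (switchedPlane p) (oppositePlane p) := by
  rw [Submodule.disjoint_def]
  rintro ⟨⟨x, y⟩, ⟨z, t⟩⟩ h h'
  rw [mem_switchedPlane] at h
  rw [mem_oppositePlane] at h'
  simp_all

lemma exists_ne_zero_of_functional {M : Submodule (ZMod p) (PhaseSpace p)} (hM : IsLagrangian M)
    (f : PhaseSpace p →ₗ[ZMod p] ZMod p) : ∃ u ∈ M, u ≠ 0 ∧ f u = 0 := by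
  have h := LinearMap.ker_ne_bot_of_finrank_lt (f := f.domRestrict M)
    (by rw [hM.finrank_eq, Module.finrank_self]; norm_num)
  obtain ⟨u, hu, h0⟩ := Submodule.exists_mem_ne_zero_of_ne_bot h
  exact ⟨u, u.2, fun h => h0 (Subtype.ext h), hu⟩

/-- A Lagrangian plane `M` disjoint from `switchedPlane` and from the graph planes with `a ≠ 0` has
a basis of a special form. Indeed, a point of `M` with `x₂ = 0` has `x₁ = 0`, as otherwise it is on
one of these planes; by dimension such a point exists, and so does one with `y₁ = 0`. -/
lemma exists_normal_form {r s : ZMod p} {M : Submodule (ZMod p) (PhaseSpace p)}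
    (hM : IsLagrangian M) (hl : Disjoint M (switchedPlane p))
    (hg : ∀ a b, a ≠ 0 → Disjoint M (graphPlane r s a b)) :
    ∃ μ ν : ZMod p, ((0, 0), (1, μ)) ∈ M ∧ ((μ, -1), (0, ν)) ∈ M := by
  have hl' : ∀ u ∈ M, u.1.2 = 0 → u.2.1 = 0 → u = 0 := fun u hu h1 h2 =>
    Submodule.disjoint_def.1 hl u hu (mem_switchedPlane.2 ⟨h1, h2⟩)
  have hx : ∀ u ∈ M, u.1.2 = 0 → u.1.1 = 0 := by
    intro u hu h2
    by_contra h1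
    have h3 : u.2.1 ≠ 0 := fun h3 => h1 (by rw [hl' u hu h2 h3]; rfl)
    refine h1 ?_
    rw [Submodule.disjoint_def.1 (hg (u.2.1 / u.1.1) (u.2.2 / u.1.1) (div_ne_zero h3 h1)) u hu
      (mem_graphPlane.2 (by rw [h2]; field_simp; simp))]
    rfl
  obtain ⟨u, hu, hu0, hu2⟩ := exists_ne_zero_of_functional hM
    (LinearMap.snd _ _ _ ∘ₗ LinearMap.fst _ _ _)
  obtain ⟨v, hv, hv0, hv2⟩ := exists_ne_zero_of_functional hM
    (LinearMap.fst _ _ _ ∘ₗ LinearMap.snd _ _ _)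
  simp only [LinearMap.comp_apply, LinearMap.fst_apply, LinearMap.snd_apply] at hu2 hv2
  have hu1 := hx u hu hu2
  have hu3 : u.2.1 ≠ 0 := fun h => hu0 (hl' u hu hu2 h)
  have hv3 : v.1.2 ≠ 0 := fun h => hv0 (hl' v hv h hv2)
  have hw : ((0, 0), (1, u.2.2 / u.2.1)) ∈ M := by
    convert M.smul_mem (u.2.1)⁻¹ hu using 1
    ext <;> simp [hu1, hu2, hu3, div_eq_inv_mul]
  have hw' : ((-(v.1.1 / v.1.2), -1), (0, -(v.2.2 / v.1.2))) ∈ M := by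
    convert M.smul_mem (-(v.1.2)⁻¹) hv using 1
    ext <;> simp [hv2, hv3, div_eq_inv_mul]
  -- Isotropy identifies the two slopes.
  have hμ := hM.isotropic _ hw _ hw'
  simp only [dot] at hμ
  have hμ' : -(v.1.1 / v.1.2) = u.2.2 / u.2.1 := by linear_combination hμ
  exact ⟨_, _, hw, hμ' ▸ hw'⟩

/-- The condition for `(μ, -1; 0, ν) + (a * μ - b) • (0, 0; 1, μ)` to lie on the graph plane. -/
lemma not_disjoint_of_solution {r s μ ν a b : ZMod p} {M : Submodule (ZMod p) (PhaseSpace p)}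
    (h1 : ((0, 0), (1, μ)) ∈ M) (h2 : ((μ, -1), (0, ν)) ∈ M)
    (hab : (2 * μ - s) * b - (r + μ ^ 2) * a = ν) : ¬ Disjoint M (graphPlane r s a b) := by
  intro hd
  have h3 := Submodule.disjoint_def.1 hd _ (M.add_mem h2 (M.smul_mem (a * μ - b) h1))
    (mem_graphPlane.2 (by
      constructor
      · simp; ring
      · simp; linear_combination -hab))
  simpa using congrArg (fun u => u.1.2) h3

lemma card_units_prod : Fintype.card ((ZMod p)ˣ × ZMod p) + p = p ^ 2 := by
  have := (Fact.out : p.Prime).one_lt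
  rw [Fintype.card_prod, ZMod.card_units, ZMod.card, ← Nat.succ_mul, sq]
  congr 1
  omega

lemma anisotropic_two : ∀ a b : ZMod 2, 1 * a ^ 2 + 1 * a * b - b ^ 2 = 0 → a = 0 ∧ b = 0 := by
  decide

/-- For `p = 2` the partial spread consists of `switchedPlane` and the graph planes with `a ≠ 0`,
for the irreducible polynomial `t ^ 2 - t - 1`. -/
lemma hasUnextendibleClasses_two [Fact (Nat.Prime 2)] :
    HasUnextendibleClasses 2 (2 ^ 2 - 2 + 1) := by
  let L : Option ((ZMod 2)ˣ × ZMod 2) → Submodule (ZMod 2) (PhaseSpace 2) := fun i =>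
    i.elim (switchedPlane 2) fun ab => graphPlane 1 1 ab.1 ab.2
  have hcard : 2 ^ 2 - 2 + 1 = Fintype.card (Option ((ZMod 2)ˣ × ZMod 2)) := by
    have := card_units_prod (p := 2)
    rw [Fintype.card_option]
    omega
  rw [hcard]
  refine hasUnextendibleClasses_of_maximal_partial_spread L ?_ ?_ ?_
  · rintro (_ | ⟨a, b⟩)
    exacts [isLagrangian_switchedPlane, isLagrangian_graphPlane _ _ _ _]
  · rintro (_ | ⟨a, b⟩) (_ | ⟨a', b'⟩) hne
    · exact absurd rfl hne
    · exact (disjoint_graphPlane_switchedPlane a'.ne_zero).symm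
    · exact disjoint_graphPlane_switchedPlane a.ne_zero
    · refine disjoint_graphPlane anisotropic_two fun h => hne ?_
      rw [show a = a' from Units.ext h.1, show b = b' from h.2]
  · intro M hM hd
    -- As `2 * μ = 0`, the equation for `a = 1` and `b` is `-b - (1 + μ ^ 2) = ν`.
    obtain ⟨μ, ν, h1, h2⟩ := exists_normal_form hM (hd none) fun a b ha =>
      hd (some (Units.mk0 a ha, b))
    refine not_disjoint_of_solution h1 h2 ?_ (hd (some (1, -(1 + μ ^ 2) - ν)))
    have h20 : (2 : ZMod 2) = 0 := rfl
    push_cast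
    linear_combination μ * (-(1 + μ ^ 2) - ν) * h20

/-- For odd `p` the partial spread consists of `switchedPlane`, `oppositePlane` and the graph planes
with `a ≠ 0`, for the irreducible polynomial `t ^ 2 - r` with a nonsquare `r`. -/
lemma hasUnextendibleClasses_of_ne_two (hp : p ≠ 2) :
    HasUnextendibleClasses p (p ^ 2 - p + 2) := by
  have h2 : (2 : ZMod p) ≠ 0 := by
    have := ZMod.ringChar_zmod_n p
    exact Ring.two_ne_zero (by rwa [this])
  obtain ⟨r, hr⟩ := FiniteField.exists_nonsquare (F := ZMod p) (by rwa [ZMod.ringChar_zmod_n])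
  have hr0 : r ≠ 0 := fun h => hr (h ▸ IsSquare.zero)
  let L : Option (Option ((ZMod p)ˣ × ZMod p)) → Submodule (ZMod p) (PhaseSpace p) := fun i =>
    i.elim (oppositePlane p) fun j => j.elim (switchedPlane p) fun ab => graphPlane r 0 ab.1 ab.2
  have hcard : p ^ 2 - p + 2 = Fintype.card (Option (Option ((ZMod p)ˣ × ZMod p))) := by
    have := card_units_prod (p := p)
    rw [Fintype.card_option, Fintype.card_option]
    omega
  rw [hcard]
  refine hasUnextendibleClasses_of_maximal_partial_spread L ?_ ?_ ?_
  · rintro (_ | _ | ⟨a, b⟩)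
    exacts [isLagrangian_oppositePlane, isLagrangian_switchedPlane,
      isLagrangian_graphPlane _ _ _ _]
  · have haniso : ∀ a b : ZMod p, r * a ^ 2 + 0 * a * b - b ^ 2 = 0 → a = 0 ∧ b = 0 := by
      intro a b h
      have ha : a = 0 := by
        by_contra ha
        refine hr ⟨b / a, ?_⟩
        field_simp
        linear_combination h
      subst ha
      simpa using h
    rintro (_ | _ | ⟨a, b⟩) (_ | _ | ⟨a', b'⟩) hne
    · exact absurd rfl hne
    · exact disjoint_switchedPlane_oppositePlane.symm
    · exact (disjoint_graphPlane_oppositePlane hr0 a'.ne_zero).symm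
    · exact disjoint_switchedPlane_oppositePlane
    · exact absurd rfl hne
    · exact (disjoint_graphPlane_switchedPlane a'.ne_zero).symm
    · exact disjoint_graphPlane_oppositePlane hr0 a.ne_zero
    · exact disjoint_graphPlane_switchedPlane a.ne_zero
    · refine disjoint_graphPlane haniso fun h => hne ?_
      rw [show a = a' from Units.ext h.1, show b = b' from h.2]
  · intro M hM hd
    obtain ⟨μ, ν, hw, hv⟩ := exists_normal_form hM (hd (some none)) fun a b ha =>
      hd (some (some (Units.mk0 a ha, b)))
    have key : ∀ a b : ZMod p, a ≠ 0 → (2 * μ - 0) * b - (r + μ ^ 2) * a ≠ ν := fun a b ha h =>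
      not_disjoint_of_solution hw hv h (hd (some (some (Units.mk0 a ha, b))))
    -- A solution with `a ≠ 0` is missing only for `μ = ν = 0`, and then `M` is `oppositePlane`.
    rcases eq_or_ne μ 0 with rfl | hμ
    · rcases eq_or_ne ν 0 with rfl | hν
      · have := Submodule.disjoint_def.1 (hd none) _ hv (mem_oppositePlane.2 ⟨rfl, rfl⟩)
        simpa using congrArg (fun u => u.1.2) this
      · refine key (-ν / r) 0 (div_ne_zero (neg_ne_zero.2 hν) hr0) ?_
        field_simp
        ring
    · refine key 1 ((ν + (r + μ ^ 2)) / (2 * μ)) one_ne_zero ?_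
      field_simp
      ring

end Spread

end UnextMUB

theorem theorem1 (p : ℕ) [Fact p.Prime] :
    ∃ N : ℕ, (N = p ^ 2 - p + 1 ∨ N = p ^ 2 - p + 2) ∧
      ∃ C : Fin N → Set (Matrix (ZMod p × ZMod p) (ZMod p × ZMod p) ℂ),
        UnextMUB.IsUnextendibleClasses (UnextMUB.pauliBasis p) C ∧
        (∀ i, ∃ b : OrthonormalBasis (ZMod p × ZMod p) ℂ (EuclideanSpace ℂ (ZMod p × ZMod p)),
          UnextMUB.IsCommonEigenbasis (C i) b) ∧
        ∀ B : Fin N →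
            OrthonormalBasis (ZMod p × ZMod p) ℂ (EuclideanSpace ℂ (ZMod p × ZMod p)),
          (∀ i, UnextMUB.IsCommonEigenbasis (C i) (B i)) →
            UnextMUB.IsWeaklyUnextendibleMUBs (UnextMUB.pauliBasis p) B := by
  rcases eq_or_ne p 2 with rfl | hp
  · exact ⟨_, Or.inl rfl, UnextMUB.hasUnextendibleClasses_two⟩
  · exact ⟨_, Or.inr rfl, UnextMUB.hasUnextendibleClasses_of_ne_two hp⟩
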